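/- Let $U$ be a real Hilbert space, let $Q:U\to U$ be a bounded self-adjoint non-negative linear operator, and let $U_0=Q^{1/2}(U)$ be the Hilbert space with the norm $\|u\|_{U_0}=\|Q^{-1/2}u\|_U$, where $Q^{-1/2}u$ is the preimage of $u$ under $Q^{1/2}$ that is orthogonal to $\ker Q^{1/2}$ (the only preimage when $Q$ is injective). Let $U_1$ be a separable real Hilbert space such that $U$ is continuously embedded into $U_1$ and the embedding of $U_0$ into $U_1$ is a Hilbert–Schmidt operator. Let $\{g_j\}$ be a countable orthonormal basis of $U_0$, let $(\Omega,\mathcal F,(\mathcal F_t)_{t\ge 0},P)$ be a filtered probability space, and let $\{\beta_j\}$ be a family of independent standard real Wiener processes on it (almost surely continuous and adapted to $(\mathcal F_t)$). Then for every $t\ge 0$ the series $$W_c(t)=\sum_j g_j\beta_j(t)$$ converges (unconditionally) in $L^2(\Omega,\mathcal F,P;U_1)$, and it defines a Wiener process in $U_1$ whose covariance operator $Q_1:U_1\to U_1$ is trace class. That is, there are a bounded symmetric non-negative nuclear operator $Q_1$ on $U_1$, with $\operatorname{tr}Q_1=\sum_k (Q_1h_k,h_k)_{U_1}<\infty$ for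 every orthonormal basis $\{h_k\}$ of $U_1$, and a square integrable $U_1$-valued process $W_c$ such that for every $t\ge 0$ the random variable $W_c(t)$ is the $L^2$-sum of the series, and 1. $W_c(0)=0$ almost surely; 2. $E\,W_c(t)=0$ for all $t\ge0$, and $\mathrm{Cov}[W_c(t)-W_c(s)]=(t-s)Q_1$ for all $0\le s\le t$; 3. $W_c$ has independent increments; 4. almost all trajectories of $W_c$ are continuous; 5. $W_c(t)$ is $\mathcal F_t$-measurable for every $t\ge 0$. Moreover, $W_c$ is a Gaussian process. -/

import Mathlib

open MeasureTheory ProbabilityTheory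
open scoped NNReal ENNReal Topology RealInnerProductSpace

/-! ### The positive square root of a bounded positive operator on a real Hilbert space -/

section SquareRoot

variable {U : Type*} [NormedAddCommGroup U] [InnerProductSpace ℝ U] [CompleteSpace U]

/-- A contraction version: if `A` is self-adjoint with `‖A‖ ≤ 1`, there is a self-adjoint `Y` with
`‖Y‖ ≤ 1` and `2 Y = A + Y ^ 2`, that is `(1 - Y) ^ 2 = 1 - A`. -/
theorem exists_fixed_of_norm_le_one (A : U →L[ℝ] U) (hA : A.IsSymmetric) (hA1 : ‖A‖ ≤ 1) :
    ∃ Y : U →L[ℝ] U, Y.IsSymmetric ∧ ‖Y‖ ≤ 1 ∧ (1 - Y) * (1 - Y) = 1 - A := by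
  let Y : ℕ → (U →L[ℝ] U) := fun n => Nat.rec 0 (fun _ Z => (1 / 2 : ℝ) • (A + Z * Z)) n
  let y : ℕ → ℝ := fun n => Nat.rec 0 (fun _ z => (1 / 2 : ℝ) * (1 + z * z)) n
  have hY : ∀ n, Y (n + 1) = (1 / 2 : ℝ) • (A + Y n * Y n) := fun n => rfl
  have hy : ∀ n, y (n + 1) = (1 / 2 : ℝ) * (1 + y n * y n) := fun n => rfl
  have hy0 : ∀ n, 0 ≤ y n ∧ y n ≤ 1 := by
    intro n
    induction n with
    | zero => exact ⟨le_refl _, zero_le_one⟩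
    | succ n ih => rw [hy]; constructor <;> nlinarith [ih.1, ih.2]
  have hymono : Monotone y := by
    refine monotone_nat_of_le_succ fun n => ?_
    rw [hy]; nlinarith [sq_nonneg (1 - y n)]
  have hYy : ∀ n, ‖Y n‖ ≤ y n := by
    intro n
    induction n with
    | zero => simp [Y, y]
    | succ n ih =>
      rw [hY, hy, norm_smul, Real.norm_of_nonneg (by norm_num : (0 : ℝ) ≤ 1 / 2)]
      have h1 := norm_add_le A (Y n * Y n)
      have h2 := norm_mul_le (Y n) (Y n)
      have h3 := mul_le_mul ih ih (norm_nonneg _) (hy0 n).1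
      linarith
  have hd : ∀ n, ‖Y (n + 1) - Y n‖ ≤ y (n + 1) - y n := by
    intro n
    induction n with
    | zero =>
      have h0 : Y 0 = 0 := rfl
      have h0' : y 0 = 0 := rfl
      have := hYy 1
      simpa [h0, h0'] using this
    | succ n ih =>
      have e : Y (n + 1 + 1) - Y (n + 1) = (1 / 2 : ℝ) •
          (Y (n + 1) * (Y (n + 1) - Y n) + (Y (n + 1) - Y n) * Y n) := by
        rw [hY (n + 1)]
        conv_lhs => rw [show Y (n + 1) = (1 / 2 : ℝ) • (A + Y n * Y n) from hY n]
        rw [← smul_sub]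
        rw [← hY n]
        congr 1
        noncomm_ring
      rw [e, norm_smul, Real.norm_of_nonneg (by norm_num : (0 : ℝ) ≤ 1 / 2)]
      have h1 := norm_add_le (Y (n + 1) * (Y (n + 1) - Y n)) ((Y (n + 1) - Y n) * Y n)
      have h2 := norm_mul_le (Y (n + 1)) (Y (n + 1) - Y n)
      have h3 := norm_mul_le (Y (n + 1) - Y n) (Y n)
      have h4 := mul_le_mul (hYy (n + 1)) ih (norm_nonneg _) (hy0 (n + 1)).1
      have h5 := mul_le_mul ih (hYy n) (norm_nonneg _) ((norm_nonneg _).trans ih)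
      have h6 := hy (n + 1)
      have h7 := hy n
      nlinarith
  have hycauchy : CauchySeq y :=
    (tendsto_atTop_ciSup hymono ⟨1, by rintro _ ⟨n, rfl⟩; exact (hy0 n).2⟩).cauchySeq
  have hdist : ∀ m n, m ≤ n → ‖Y n - Y m‖ ≤ y n - y m := by
    intro m n hmn
    induction n, hmn using Nat.le_induction with
    | base => simp
    | succ n _ ih =>
      have := norm_add_le (Y (n + 1) - Y n) (Y n - Y m)
      rw [sub_add_sub_cancel] at this
      linarith [hd n]
  have hYcauchy : CauchySeq Y := by
    rw [Metric.cauchySeq_iff'] at hycauchy ⊢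
    intro ε hε
    obtain ⟨N, hN⟩ := hycauchy ε hε
    refine ⟨N, fun n hn => ?_⟩
    rw [dist_eq_norm]
    have := hN n hn
    rw [Real.dist_eq] at this
    exact (hdist N n hn).trans_lt ((le_abs_self _).trans_lt this)
  obtain ⟨L, hL⟩ := cauchySeq_tendsto_of_complete hYcauchy
  have hYsymm : ∀ n, (Y n).IsSymmetric := by
    intro n
    induction n with
    | zero => intro a b; simp [Y]
    | succ n ih =>
      intro a b
      have h1 : ⟪A a, b⟫ = ⟪a, A b⟫ := hA a b
      have h2 : ⟪Y n (Y n a), b⟫ = ⟪Y n a, Y n b⟫ := ih (Y n a) b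
      have h3 : ⟪Y n a, Y n b⟫ = ⟪a, Y n (Y n b)⟫ := ih a (Y n b)
      rw [hY]
      simp [inner_add_left, inner_add_right, inner_smul_left, inner_smul_right, h1, h2, h3]
  have hev : ∀ a, Filter.Tendsto (fun n => Y n a) Filter.atTop (𝓝 (L a)) := fun a =>
    ((ContinuousLinearMap.apply ℝ U a).continuous.tendsto L).comp hL
  refine ⟨L, ?_, ?_, ?_⟩
  · intro a b
    refine tendsto_nhds_unique ((hev a).inner tendsto_const_nhds)
      (Filter.Tendsto.congr (fun n => ((hYsymm n) a b).symm) (tendsto_const_nhds.inner (hev b)))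
  · exact le_of_tendsto hL.norm (Filter.Eventually.of_forall fun n => (hYy n).trans (hy0 n).2)
  · have h1 : Filter.Tendsto (fun n => Y (n + 1)) Filter.atTop (𝓝 L) :=
      hL.comp (Filter.tendsto_add_atTop_nat 1)
    have h2 : Filter.Tendsto (fun n => Y (n + 1)) Filter.atTop (𝓝 ((1 / 2 : ℝ) • (A + L * L))) :=
      (tendsto_const_nhds.add (hL.mul hL)).const_smul _
    have h3 : L = (1 / 2 : ℝ) • (A + L * L) := tendsto_nhds_unique h1 h2
    have h4 : L + L = A + L * L := by
      conv_lhs => rw [h3]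
      rw [← add_smul]; norm_num
    have : (1 - L) * (1 - L) = 1 - (L + L) + L * L := by noncomm_ring
    rw [this, h4]; abel

/-- Every bounded positive operator on a real Hilbert space has a bounded positive square root. -/
theorem exists_isPositive_mul_self_eq (Q : U →L[ℝ] U) (hQ : Q.IsPositive) :
    ∃ S : U →L[ℝ] U, S.IsPositive ∧ S * S = Q := by
  set c : ℝ := ‖Q‖ + 1 with hc
  have hc0 : 0 < c := by positivity
  have hQs : ∀ a b : U, ⟪Q a, b⟫ = ⟪a, Q b⟫ := fun a b => hQ.isSymmetric a b
  set A : U →L[ℝ] U := 1 - c⁻¹ • Q with hAdef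
  have hAs : A.IsSymmetric := by
    intro a b
    simp [A, inner_sub_left, inner_sub_right, inner_smul_left, inner_smul_right, hQs a b]
  have hA1 : ‖A‖ ≤ 1 := by
    rw [ContinuousLinearMap.norm_eq_iSup_rayleighQuotient A hAs]
    refine ciSup_le fun x => ?_
    have hx : ⟪A x, x⟫ = ‖x‖ ^ 2 - c⁻¹ * ⟪Q x, x⟫ := by
      simp [A, inner_sub_left, inner_smul_left]
    have h0 : 0 ≤ ⟪Q x, x⟫ := hQ.inner_nonneg_left x
    have h1 : ⟪Q x, x⟫ ≤ c * ‖x‖ ^ 2 := by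
      have := real_inner_le_norm (Q x) x
      have h2 := mul_le_mul_of_nonneg_right (Q.le_opNorm x) (norm_nonneg x)
      nlinarith [sq_nonneg ‖x‖]
    have h2 : c⁻¹ * ⟪Q x, x⟫ ≤ ‖x‖ ^ 2 := by
      rw [inv_mul_le_iff₀ hc0]; exact h1
    have h3 : 0 ≤ c⁻¹ * ⟪Q x, x⟫ := by positivity
    rw [ContinuousLinearMap.rayleighQuotient, ContinuousLinearMap.reApplyInnerSelf_apply, abs_div,
      abs_of_nonneg (sq_nonneg ‖x‖)]
    refine div_le_one_of_le₀ ?_ (sq_nonneg _)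
    simp only [RCLike.re_to_real]
    rw [hx, abs_le]
    constructor <;> linarith
  obtain ⟨Y, hYs, hY1, hY⟩ := exists_fixed_of_norm_le_one A hAs hA1
  have hYs' : ∀ a b : U, ⟪Y a, b⟫ = ⟪a, Y b⟫ := fun a b => hYs a b
  refine ⟨√c • (1 - Y), ⟨?_, ?_⟩, ?_⟩
  · intro a b
    simp [inner_sub_left, inner_sub_right, inner_smul_left, inner_smul_right, hYs' a b]
  · intro x
    have h1 : ⟪Y x, x⟫ ≤ ‖x‖ ^ 2 := by
      have := real_inner_le_norm (Y x) x
      have h2 := Y.le_opNorm x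
      nlinarith [norm_nonneg x, norm_nonneg (Y x), mul_le_mul_of_nonneg_right hY1 (norm_nonneg x)]
    have h2 : (√c • (1 - Y)).reApplyInnerSelf x = √c * (‖x‖ ^ 2 - ⟪Y x, x⟫) := by
      simp [ContinuousLinearMap.reApplyInnerSelf_apply, inner_sub_left, inner_smul_left]
    rw [h2]
    exact mul_nonneg (Real.sqrt_nonneg _) (by linarith)
  · rw [smul_mul_smul_comm, hY, Real.mul_self_sqrt hc0.le, hAdef, sub_sub_cancel, smul_smul,
      mul_inv_cancel₀ hc0.ne', one_smul]

open Classical in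
/-- The positive square root `Q ^ (1 / 2)` of a bounded positive operator `Q` (which exists and,
as is well known, is unique); `0` when `Q` is not positive. -/
noncomputable def opSqrt (Q : U →L[ℝ] U) : U →L[ℝ] U :=
  if h : Q.IsPositive then (exists_isPositive_mul_self_eq Q h).choose else 0

theorem opSqrt_isPositive {Q : U →L[ℝ] U} (hQ : Q.IsPositive) : (opSqrt Q).IsPositive := by
  rw [opSqrt, dif_pos hQ]
  exact (exists_isPositive_mul_self_eq Q hQ).choose_spec.1

theorem opSqrt_mul_self {Q : U →L[ℝ] U} (hQ : Q.IsPositive) : opSqrt Q * opSqrt Q = Q := by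
  rw [opSqrt, dif_pos hQ]
  exact (exists_isPositive_mul_self_eq Q hQ).choose_spec.2

end SquareRoot

/-! ### The Hilbert space `U₀ = Q ^ (1 / 2) (U)` -/

section U0

variable {U : Type*} [NormedAddCommGroup U] [InnerProductSpace ℝ U] [CompleteSpace U]

/-- The space `U₀ = Q ^ (1 / 2) (U)`. It is a type of its own, since it does not carry the norm of
`U` but the norm `‖u‖₀ = ‖Q ^ (-1 / 2) u‖`. -/
def U0 (Q : U →L[ℝ] U) : Type _ := LinearMap.range (opSqrt Q).toLinearMap

namespace U0

variable (Q : U →L[ℝ] U)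

noncomputable instance : AddCommGroup (U0 Q) :=
  inferInstanceAs (AddCommGroup (LinearMap.range (opSqrt Q).toLinearMap))

noncomputable instance : Module ℝ (U0 Q) :=
  inferInstanceAs (Module ℝ (LinearMap.range (opSqrt Q).toLinearMap))

theorem isCompl_ker :
    IsCompl (LinearMap.ker (opSqrt Q).toLinearMap)ᗮ (LinearMap.ker (opSqrt Q).toLinearMap) := by
  have : CompleteSpace (LinearMap.ker (opSqrt Q).toLinearMap) :=
    (ContinuousLinearMap.isClosed_ker (opSqrt Q)).completeSpace_coe
  exact (Submodule.isCompl_orthogonal _).symm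

/-- The (pseudo-)inverse `Q ^ (-1 / 2)` on `U₀`: it sends `u` to the only preimage of `u` under
`Q ^ (1 / 2)` that is orthogonal to the kernel of `Q ^ (1 / 2)`. When `Q` is injective, this is the
only preimage of `u`. -/
noncomputable def sqrtInv : U0 Q ≃ₗ[ℝ] (LinearMap.ker (opSqrt Q).toLinearMap)ᗮ :=
  (LinearMap.kerComplementEquivRange (opSqrt Q).toLinearMap (isCompl_ker Q)).symm

/-- The underlying vector of `U`. -/
def val (u : U0 Q) : U := Subtype.val u

theorem opSqrt_sqrtInv (u : U0 Q) : opSqrt Q (sqrtInv Q u : U) = u.val := by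
  have h : (LinearMap.kerComplementEquivRange (opSqrt Q).toLinearMap (isCompl_ker Q))
      (sqrtInv Q u) = u := LinearEquiv.apply_symm_apply _ u
  exact congrArg Subtype.val h

/-- The norm `‖u‖₀ = ‖Q ^ (-1 / 2) u‖`. -/
noncomputable instance : NormedAddCommGroup (U0 Q) :=
  NormedAddCommGroup.induced (U0 Q) ((LinearMap.ker (opSqrt Q).toLinearMap)ᗮ : Submodule ℝ U)
    (sqrtInv Q) (sqrtInv Q).injective

theorem norm_def (u : U0 Q) : ‖u‖ = ‖(sqrtInv Q u : U)‖ := rfl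

/-- The inner product `⟪u, v⟫₀ = ⟪Q ^ (-1 / 2) u, Q ^ (-1 / 2) v⟫`. -/
noncomputable instance : InnerProductSpace ℝ (U0 Q) where
  norm_smul_le a u := by
    rw [norm_def, norm_def, map_smul, Submodule.coe_smul, norm_smul]
  inner u v := ⟪(sqrtInv Q u : U), (sqrtInv Q v : U)⟫
  norm_sq_eq_re_inner u := by
    rw [norm_def]; simp
  conj_inner_symm u v := by
    simp [real_inner_comm]
  add_left u v w := by
    simp [inner_add_left]
  smul_left u v r := by
    simp [inner_smul_left]

theorem inner_def (u v : U0 Q) : ⟪u, v⟫ = ⟪(sqrtInv Q u : U), (sqrtInv Q v : U)⟫ := rfl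

instance : CompleteSpace (U0 Q) := by
  let e : U0 Q ≃ₗᵢ[ℝ] ((LinearMap.ker (opSqrt Q).toLinearMap)ᗮ : Submodule ℝ U) :=
    ⟨sqrtInv Q, fun _ => rfl⟩
  exact (completeSpace_congr (e := e.toLinearEquiv.toEquiv) e.isometry.isUniformEmbedding).2 inferInstance

/-- The inclusion of `U₀` into `U`, as a bounded operator. -/
noncomputable def incl : U0 Q →L[ℝ] U :=
  LinearMap.mkContinuous
    ({ toFun := fun u => u.val
       map_add' := fun _ _ => rfl
       map_smul' := fun _ _ => rfl } : U0 Q →ₗ[ℝ] U) ‖opSqrt Q‖ (by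
    intro u
    have h : ‖u.val‖ ≤ ‖opSqrt Q‖ * ‖u‖ := by
      rw [norm_def, ← opSqrt_sqrtInv]
      exact (opSqrt Q).le_opNorm _
    exact h)

theorem incl_apply (u : U0 Q) : incl Q u = u.val := rfl

end U0

end U0

/-! ### Hilbert-Schmidt, nuclear and finite-trace operators -/

section Operators

variable {E F : Type*} [NormedAddCommGroup E] [InnerProductSpace ℝ E]
  [NormedAddCommGroup F] [InnerProductSpace ℝ F]

/-- `T` is a Hilbert-Schmidt operator: `∑ ‖T e_k‖ ^ 2 < ∞` for an orthonormal basis `e` of `E`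
(every orthonormal basis can be indexed by the set of its vectors; the sum does not depend on the
basis). -/
def IsHilbertSchmidt (T : E →L[ℝ] F) : Prop :=
  ∃ (s : Set E) (e : HilbertBasis s ℝ E), Summable fun k => ‖T (e k)‖ ^ 2

/-- `T` is a nuclear operator: `T x = ∑ ⟪b n, x⟫ a n` with `∑ ‖a n‖ ‖b n‖ < ∞`. -/
def IsNuclear (T : E →L[ℝ] E) : Prop :=
  ∃ a b : ℕ → E, Summable (fun n => ‖a n‖ * ‖b n‖) ∧
    ∀ x, HasSum (fun n => ⟪b n, x⟫ • a n) (T x)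

/-- `tr T < ∞` for a positive operator `T`: the series `∑ ⟪T h_k, h_k⟫` converges for every
orthonormal basis `h` of `E`. -/
def HasFiniteTrace (T : E →L[ℝ] E) : Prop :=
  ∀ (s : Set E) (h : HilbertBasis s ℝ E), Summable fun k => ⟪T (h k), h k⟫

end Operators

/-! ### Wiener processes in a Hilbert space -/

/-- `W` is a Wiener process with values in the Hilbert space `E`, with covariance operator `Q`, with
respect to the filtration `ℱ`. -/
structure IsWienerProcess {E : Type*} [NormedAddCommGroup E] [InnerProductSpace ℝ E]
    [MeasurableSpace E] {Ω : Type*} {mΩ : MeasurableSpace Ω} (W : ℝ≥0 → Ω → E) (Q : E →L[ℝ] E)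
    (ℱ : Filtration ℝ≥0 mΩ) (P : Measure Ω) : Prop where
  /-- `Q` is symmetric and non-negative. -/
  isPositive : Q.IsPositive
  /-- `Q` is nuclear. -/
  isNuclear : IsNuclear Q
  /-- `W` is square integrable. -/
  memLp : ∀ t, MemLp (W t) 2 P
  /-- `W` starts at zero. -/
  zero : ∀ᵐ ω ∂P, W 0 ω = 0
  /-- `W t` has mean zero. -/
  mean : ∀ t, ∫ ω, W t ω ∂P = 0
  /-- The covariance operator of `W t - W s` is `(t - s) Q`. -/
  cov : ∀ s t : ℝ≥0, s ≤ t → ∀ a b : E,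
    cov[fun ω => ⟪W t ω - W s ω, a⟫, fun ω => ⟪W t ω - W s ω, b⟫; P] =
      ((t : ℝ) - (s : ℝ)) * ⟪Q a, b⟫
  /-- `W` has independent increments. -/
  indep : HasIndepIncrements W P
  /-- Almost all trajectories of `W` are continuous. -/
  continuous : ∀ᵐ ω ∂P, Continuous fun t => W t ω
  /-- `W` is adapted to the filtration. -/
  adapted : StronglyAdapted ℱ W

/-! ### Hilbert-Schmidt sums and the operator `∑ a j ⊗ a j`. -/

section CovarianceOperator

variable {ι E F : Type*} [NormedAddCommGroup E] [InnerProductSpace ℝ E]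
  [NormedAddCommGroup F] [InnerProductSpace ℝ F]

/-! Let `a j` be the image of `g j` in `U₁`. The Hilbert-Schmidt condition does not depend on the
basis, so `∑ ‖a j‖ ^ 2 < ∞`. For independent Brownian motions the cross terms vanish and `E ‖∑ j ∈
F, β j t • a j‖ ^ 2 = t * ∑ j ∈ F, ‖a j‖ ^ 2`; hence the series is Cauchy in `L²` along the net of
finite sets. The covariance operator is `Q₁ = ∑ a j ⊗ a j`, with trace `∑ ‖a j‖ ^ 2`.

Means, covariances and Gaussianity survive `L²` limits. Increments over disjoint intervals are
uncorrelated because the covariance is `min s t` times a bilinear form, and for jointly Gaussian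
vectors this gives independence.

Continuity needs more than `L²` convergence at each time. Along finite sets `F k` whose complements
carry mass at most `16⁻ᵏ`, Doob's maximal inequality and Borel-Cantelli give almost sure locally
uniform convergence of the partial sums. The process is defined as the pointwise limit along `F k`,
and the same object is then shown to be the `L²` limit over all finite sets. -/

theorem HilbertBasis.hasSum_inner_sq (b : HilbertBasis ι ℝ E) (x : E) :
    HasSum (fun k => ⟪x, b k⟫ ^ 2) (‖x‖ ^ 2) := by
  simpa [sq, real_inner_comm x, real_inner_self_eq_norm_sq] using b.hasSum_inner_mul_inner x x

theorem HilbertBasis.tsum_ofReal_inner_sq (b : HilbertBasis ι ℝ E) (x : E) :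
    ∑' k, ENNReal.ofReal (⟪x, b k⟫ ^ 2) = ENNReal.ofReal (‖x‖ ^ 2) := by
  rw [← (b.hasSum_inner_sq x).tsum_eq,
    ENNReal.ofReal_tsum_of_nonneg (fun _ => sq_nonneg _) (b.hasSum_inner_sq x).summable]

/-- Parseval in `F`, interchange of a non-negative double sum, Parseval in `E`. The right side does
not involve `e`, so the Hilbert-Schmidt sum is independent of the basis. -/
theorem HilbertBasis.tsum_norm_sq_eq_adjoint [CompleteSpace E] [CompleteSpace F] {κ : Type*}
    (e : HilbertBasis ι ℝ E) (f : HilbertBasis κ ℝ F) (T : E →L[ℝ] F) :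
    ∑' k, ENNReal.ofReal (‖T (e k)‖ ^ 2) =
      ∑' l, ENNReal.ofReal (‖ContinuousLinearMap.adjoint T (f l)‖ ^ 2) := by
  simp_rw [← f.tsum_ofReal_inner_sq, ← e.tsum_ofReal_inner_sq]
  rw [ENNReal.tsum_comm]
  refine tsum_congr fun l => tsum_congr fun k => ?_
  rw [ContinuousLinearMap.adjoint_inner_left, real_inner_comm]

theorem IsHilbertSchmidt.summable [CompleteSpace E] [CompleteSpace F] {T : E →L[ℝ] F}
    (hT : IsHilbertSchmidt T) (g : HilbertBasis ι ℝ E) : Summable fun j => ‖T (g j)‖ ^ 2 := by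
  obtain ⟨s, e, he⟩ := hT
  obtain ⟨_, f, -⟩ := exists_hilbertBasis ℝ F
  have h : ∑' j, ENNReal.ofReal (‖T (g j)‖ ^ 2) ≠ ∞ := by
    rw [g.tsum_norm_sq_eq_adjoint f T, ← e.tsum_norm_sq_eq_adjoint f T]
    exact he.tsum_ofReal_ne_top
  simpa [ENNReal.toReal_ofReal, sq_nonneg] using ENNReal.summable_toReal h

/-- The operator `∑ j, a j ⊗ a j`. -/
noncomputable def covOp (a : ι → E) : E →L[ℝ] E :=
  ∑' j, (innerSL ℝ (a j)).smulRight (a j)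

variable [CompleteSpace E] {a : ι → E}

/-- The rank-one operator `a j ⊗ a j` has norm `‖a j‖ ^ 2`, so the series defining `covOp` converges
absolutely in operator norm and may be evaluated at `x`. -/
theorem hasSum_covOp (ha : Summable fun j => ‖a j‖ ^ 2) (x : E) :
    HasSum (fun j => ⟪a j, x⟫ • a j) (covOp a x) := by
  have h : Summable fun j => (innerSL ℝ (a j)).smulRight (a j) := by
    refine Summable.of_norm_bounded ha fun j => ?_
    rw [ContinuousLinearMap.norm_smulRight_apply, innerSL_apply_norm, sq]
  simpa [covOp] using h.hasSum.mapL (ContinuousLinearMap.apply ℝ E x)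

theorem hasSum_inner_covOp (ha : Summable fun j => ‖a j‖ ^ 2) (x y : E) :
    HasSum (fun j => ⟪a j, x⟫ * ⟪a j, y⟫) ⟪covOp a x, y⟫ := by
  have h := (hasSum_covOp ha x).mapL (innerSL ℝ y)
  simpa [inner_smul_right, real_inner_comm] using h

theorem covOp_isPositive (ha : Summable fun j => ‖a j‖ ^ 2) : (covOp a).IsPositive := by
  refine ⟨fun x y => ?_, fun x => ?_⟩
  · have h := (hasSum_inner_covOp ha x y).unique
      ((hasSum_inner_covOp ha y x).congr_fun fun j => mul_comm _ _)
    rw [real_inner_comm x] at h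
    exact h
  · rw [ContinuousLinearMap.reApplyInnerSelf_apply]
    exact (hasSum_inner_covOp ha x x).nonneg fun j => mul_self_nonneg _

theorem covOp_isNuclear [Countable ι] (ha : Summable fun j => ‖a j‖ ^ 2) :
    IsNuclear (covOp a) := by
  -- Nuclear expansions are indexed by `ℕ`: the family is transported along an injection and padded
  -- by zeros.
  obtain ⟨e, he⟩ := exists_injective_nat ι
  have h0 : ∀ n, n ∉ Set.range e → Function.extend e a 0 n = 0 := fun n hn =>
    Function.extend_apply' _ _ _ (by simpa using hn)
  refine ⟨Function.extend e a 0, Function.extend e a 0, ?_, fun x => ?_⟩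
  · refine (he.summable_iff fun n hn => by simp [h0 n hn]).1 ?_
    simpa [Function.comp_def, he.extend_apply, sq] using ha
  · refine (he.hasSum_iff fun n hn => by simp [h0 n hn]).1 ?_
    simpa [Function.comp_def, he.extend_apply] using hasSum_covOp ha x

/-- Interchanging the sums over `k` and `j` and applying Parseval turns the trace into `∑ ‖a j‖ ^
2`. -/
theorem covOp_hasFiniteTrace (ha : Summable fun j => ‖a j‖ ^ 2) : HasFiniteTrace (covOp a) := by
  intro s h
  have key : ∑' k, ENNReal.ofReal ⟪covOp a (h k), h k⟫ ≠ ∞ := by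
    have h1 : ∀ k, ENNReal.ofReal ⟪covOp a (h k), h k⟫ =
        ∑' j, ENNReal.ofReal (⟪a j, h k⟫ ^ 2) := fun k => by
      have h2 := hasSum_inner_covOp ha (h k) (h k)
      simp_rw [← sq] at h2
      rw [← h2.tsum_eq, ENNReal.ofReal_tsum_of_nonneg (fun _ => sq_nonneg _) h2.summable]
    simp_rw [h1]
    rw [ENNReal.tsum_comm]
    simp_rw [h.tsum_ofReal_inner_sq]
    exact ha.tsum_ofReal_ne_top
  have h2 := ENNReal.summable_toReal key
  refine h2.congr fun k => ENNReal.toReal_ofReal ?_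
  exact (covOp_isPositive ha).inner_nonneg_left (h k)

end CovarianceOperator

theorem NNReal.tendsto_floor_mul_two_pow_div (t : ℝ≥0) :
    Filter.Tendsto (fun n : ℕ => (⌊t * 2 ^ n⌋₊ : ℝ≥0) / 2 ^ n) Filter.atTop (𝓝 t) := 
by
  rw [← NNReal.tendsto_coe]
  have h := (tendsto_nat_floor_mul_div_atTop t.coe_nonneg).comp
    (tendsto_pow_atTop_atTop_of_one_lt (one_lt_two (α := ℝ)))
  refine h.congr fun n => ?_
  have h1 : ⌊(t : ℝ) * 2 ^ n⌋₊ = ⌊t * 2 ^ n⌋₊ := by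
    refine eq_of_forall_le_iff fun m => ?_
    rw [Nat.le_floor_iff (by positivity), Nat.le_floor_iff zero_le]
    exact_mod_cast Iff.rfl
  simp [h1]

/-! ### Doob's maximal inequality, in discrete and continuous time. -/

section MaximalInequality

variable {E Ω : Type*} [NormedAddCommGroup E] [NormedSpace ℝ E] [CompleteSpace E]
  {mΩ : MeasurableSpace Ω} {P : Measure Ω}

/-- Conditional Jensen inequality for the convex function `‖·‖`. -/
theorem submartingale_norm_of_martingale [IsFiniteMeasure P] {M : ℕ → Ω → E}
    {𝒢 : Filtration ℕ mΩ} (hM : Martingale M 𝒢 P) :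
    Submartingale (fun n ω => ‖M n ω‖) 𝒢 P := by
  refine submartingale_nat (fun n => (hM.stronglyAdapted n).norm)
    (fun n => (hM.integrable n).norm) fun n => ?_
  have h := convexOn_univ_norm.map_condExp_le_univ (μ := P) (𝒢.le n)
    (continuous_norm (E := E)).lowerSemicontinuous (hM.integrable (n + 1)) (hM.integrable (n + 1)).norm
  filter_upwards [h, hM.condExp_ae_eq n.le_succ] with ω h1 h2
  rw [← h2]
  exact h1

variable [MeasurableSpace E] [BorelSpace E] [SecondCountableTopology E]

theorem martingale_sum_of_iIndepFun [IsProbabilityMeasure P] {D : ℕ → Ω → E}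
    (hD : ∀ n, StronglyMeasurable (D n)) (hint : ∀ n, Integrable (D n) P)
    (hmean : ∀ n, ∫ ω, D n ω ∂P = 0) (hindep : iIndepFun D P) :
    Martingale (fun n ω => ∑ i ∈ Finset.range (n + 1), D i ω) (Filtration.natural D hD) P := by
  refine martingale_of_condExp_sub_eq_zero_nat (fun n => ?_)
    (fun n => integrable_finsetSum _ fun i _ => hint i) fun n => ?_
  · refine Finset.stronglyMeasurable_fun_sum _ fun i hi => ?_
    exact (Filtration.stronglyAdapted_natural hD i).mono
      ((Filtration.natural D hD).mono (by simpa [Nat.lt_succ_iff] using hi))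
  · have h1 : (fun ω => ∑ i ∈ Finset.range (n + 1 + 1), D i ω) -
        (fun ω => ∑ i ∈ Finset.range (n + 1), D i ω) = D (n + 1) := by
      ext ω; simp [Finset.sum_range_succ _ (n + 1)]
    rw [h1]
    have h2 := hindep.condExp_natural_ae_eq_of_lt hD n.lt_succ_self
    filter_upwards [h2] with ω hω
    rw [hω, hmean]; rfl

/-- A maximal inequality for sums of independent centered random vectors. -/
theorem measure_exists_le_norm_sum [IsProbabilityMeasure P] {D : ℕ → Ω → E}
    (hD : ∀ n, StronglyMeasurable (D n)) (hint : ∀ n, Integrable (D n) P)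
    (hmean : ∀ n, ∫ ω, D n ω ∂P = 0) (hindep : iIndepFun D P) (ε : ℝ≥0) (n : ℕ) :
    ε * P {ω | ∃ k ≤ n, (ε : ℝ) ≤ ‖∑ i ∈ Finset.range (k + 1), D i ω‖} ≤
      ENNReal.ofReal (∫ ω, ‖∑ i ∈ Finset.range (n + 1), D i ω‖ ∂P) := by
  have hM := martingale_sum_of_iIndepFun hD hint hmean hindep
  have h := maximal_ineq (submartingale_norm_of_martingale hM) (fun _ _ => norm_nonneg _)
    (ε := ε) n
  simp only [Finset.le_sup'_iff, Finset.mem_range, Nat.lt_succ_iff] at h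
  refine h.trans (ENNReal.ofReal_le_ofReal ?_)
  exact setIntegral_le_integral (hM.integrable n).norm (ae_of_all _ fun _ => norm_nonneg _)

/-- The discrete inequality on the grids `k / 2 ^ n` has a bound independent of `n`; the grid events
increase, and continuity of paths makes their union cover the event, up to a null set. -/
theorem measure_exists_lt_norm_of_hasIndepIncrements [IsProbabilityMeasure P] {M : ℝ≥0 → Ω → E}
    (hM : ∀ t, StronglyMeasurable (M t)) (hint : ∀ t, Integrable (M t) P)
    (hmean : ∀ t, ∫ ω, M t ω ∂P = 0) (hindep : HasIndepIncrements M P)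
    (hzero : ∀ᵐ ω ∂P, M 0 ω = 0) (hcont : ∀ᵐ ω ∂P, Continuous fun t => M t ω)
    (ε : ℝ≥0) (T : ℕ) :
    ε * P {ω | ∃ t : ℝ≥0, t ≤ T ∧ (ε : ℝ) < ‖M t ω‖} ≤
      ENNReal.ofReal (∫ ω, ‖M T ω‖ ∂P) := by
  let A : ℕ → Set Ω := fun n => {ω | ∃ k : ℕ, k ≤ T * 2 ^ n ∧ (ε : ℝ) < ‖M (k / 2 ^ n) ω‖}
  have hA : Monotone A := by
    refine monotone_nat_of_le_succ fun n ω ⟨k, hk, h⟩ => ⟨k * 2, ?_, ?_⟩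
    · rw [pow_succ, ← mul_assoc]; exact Nat.mul_le_mul_right 2 hk
    · have : ((k * 2 : ℕ) : ℝ≥0) / 2 ^ (n + 1) = k / 2 ^ n := by
        push_cast; rw [pow_succ]; field_simp
      rwa [this]
  have hsub : {ω | ∃ t : ℝ≥0, t ≤ T ∧ (ε : ℝ) < ‖M t ω‖} ≤ᵐ[P] ⋃ n, A n := by
    filter_upwards [hcont] with ω hω
    rintro ⟨t, ht, h⟩
    -- The strict inequality at `t` persists at nearby dyadic times; it would not if `<` were `≤`.
    have h1 := ((hω.norm.tendsto t).comp (NNReal.tendsto_floor_mul_two_pow_div t)).eventually_const_lt h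
    obtain ⟨n, hn⟩ := h1.exists
    refine Set.mem_iUnion.2 ⟨n, ⌊t * 2 ^ n⌋₊, ?_, hn⟩
    refine Nat.floor_le_of_le ?_
    push_cast
    gcongr
  have hbound : ∀ n, ε * P (A n) ≤ ENNReal.ofReal (∫ ω, ‖M T ω‖ ∂P) := by
    intro n
    -- Truncated subtraction gives `τ 0 = τ 1 = 0`: the increment of index `0` vanishes, and the sum
    -- over `range (k + 1)` telescopes to the value at `k / 2 ^ n`.
    let τ : ℕ → ℝ≥0 := fun k => ((k - 1 : ℕ) : ℝ≥0) / 2 ^ n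
    have hτ : Monotone τ := fun k l hkl => by
      dsimp only [τ]; gcongr
    have hsum : ∀ k, ∀ᵐ ω ∂P,
        ∑ i ∈ Finset.range (k + 1), (M (τ (i + 1)) ω - M (τ i) ω) = M (k / 2 ^ n) ω := by
      intro k
      filter_upwards [hzero] with ω hω
      rw [Finset.sum_range_sub (fun i => M (τ i) ω)]
      simp [τ, hω]
    have h := measure_exists_le_norm_sum (P := P)
      (D := fun i ω => M (τ (i + 1)) ω - M (τ i) ω)
      (fun i => (hM _).sub (hM _)) (fun i => (hint _).sub (hint _))
      (fun i => by rw [integral_sub (hint _) (hint _), hmean, hmean, sub_zero])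
      (hindep.nat hτ) ε (T * 2 ^ n)
    refine (mul_le_mul_right (measure_mono_ae ?_) _).trans (h.trans_eq ?_)
    · filter_upwards [ae_all_iff.2 hsum] with ω hω
      rintro ⟨k, hk, h⟩
      exact ⟨k, hk, by rw [hω]; exact h.le⟩
    · congr 1
      refine integral_congr_ae ?_
      filter_upwards [hsum (T * 2 ^ n)] with ω hω
      rw [hω]
      congr 3
      push_cast
      field_simp
  have hlim := (ENNReal.Tendsto.const_mul (tendsto_measure_iUnion_atTop (μ := P) hA)
    (Or.inr (ENNReal.coe_ne_top (r := ε))))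
  exact (mul_le_mul_right (measure_mono_ae hsub) _).trans
    (le_of_tendsto hlim (Filter.Eventually.of_forall hbound))

end MaximalInequality

/-! ### Continuity of means and covariances in `L²`. -/

section L2Limits

variable {Ω κ : Type*} {mΩ : MeasurableSpace Ω} {P : Measure Ω} {l : Filter κ}

theorem tendsto_integral_mul_of_tendsto_eLpNorm {X Y : κ → Ω → ℝ} {X' Y' : Ω → ℝ}
    (hX : ∀ n, MemLp (X n) 2 P) (hY : ∀ n, MemLp (Y n) 2 P) (hX' : MemLp X' 2 P)
    (hY' : MemLp Y' 2 P) (hXX : Filter.Tendsto (fun n => eLpNorm (X n - X') 2 P) l (𝓝 0))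
    (hYY : Filter.Tendsto (fun n => eLpNorm (Y n - Y') 2 P) l (𝓝 0)) :
    Filter.Tendsto (fun n => ∫ ω, X n ω * Y n ω ∂P) l (𝓝 (∫ ω, X' ω * Y' ω ∂P)) := by
  have h1 := (Lp.tendsto_Lp_iff_tendsto_eLpNorm'' X hX X' hX').2 hXX
  have h2 := (Lp.tendsto_Lp_iff_tendsto_eLpNorm'' Y hY Y' hY').2 hYY
  have key : ∀ {f g : Ω → ℝ} (hf : MemLp f 2 P) (hg : MemLp g 2 P),
      ⟪hf.toLp f, hg.toLp g⟫ = ∫ ω, f ω * g ω ∂P := by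
    intro f g hf hg
    rw [L2.inner_def]
    refine integral_congr_ae ?_
    filter_upwards [hf.coeFn_toLp, hg.coeFn_toLp] with ω h1 h2
    rw [h1, h2, real_inner_eq_re_inner ℝ]
    simp [mul_comm]
  have h3 := h1.inner (𝕜 := ℝ) h2
  simpa only [key] using h3

theorem tendsto_integral_of_tendsto_eLpNorm_two [IsProbabilityMeasure P]
    {X : κ → Ω → ℝ} {X' : Ω → ℝ}
    (hX : ∀ n, MemLp (X n) 2 P) (hX' : MemLp X' 2 P)
    (hXX : Filter.Tendsto (fun n => eLpNorm (X n - X') 2 P) l (𝓝 0)) :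
    Filter.Tendsto (fun n => ∫ ω, X n ω ∂P) l (𝓝 (∫ ω, X' ω ∂P)) := by
  simpa using tendsto_integral_mul_of_tendsto_eLpNorm (Y := fun _ _ => 1) (Y' := fun _ => 1)
    hX (fun _ => memLp_const 1) hX' (memLp_const 1) hXX (by simpa using tendsto_const_nhds)

theorem tendsto_covariance_of_tendsto_eLpNorm [IsProbabilityMeasure P]
    {X Y : κ → Ω → ℝ} {X' Y' : Ω → ℝ}
    (hX : ∀ n, MemLp (X n) 2 P) (hY : ∀ n, MemLp (Y n) 2 P) (hX' : MemLp X' 2 P)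
    (hY' : MemLp Y' 2 P) (hXX : Filter.Tendsto (fun n => eLpNorm (X n - X') 2 P) l (𝓝 0))
    (hYY : Filter.Tendsto (fun n => eLpNorm (Y n - Y') 2 P) l (𝓝 0)) :
    Filter.Tendsto (fun n => cov[X n, Y n; P]) l (𝓝 cov[X', Y'; P]) := by
  simp_rw [covariance_eq_sub hX' hY', fun n => covariance_eq_sub (hX n) (hY n)]
  exact (tendsto_integral_mul_of_tendsto_eLpNorm hX hY hX' hY' hXX hYY).sub
    ((tendsto_integral_of_tendsto_eLpNorm_two hX hX' hXX).mul
      (tendsto_integral_of_tendsto_eLpNorm_two hY hY' hYY))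

theorem tendsto_eLpNorm_clm_comp {E F : Type*} [NormedAddCommGroup E] [NormedSpace ℝ E]
    [NormedAddCommGroup F] [NormedSpace ℝ F] (L : E →L[ℝ] F) {X : κ → Ω → E} {X' : Ω → E}
    {p : ℝ≥0∞} (h : Filter.Tendsto (fun n => eLpNorm (X n - X') p P) l (𝓝 0)) :
    Filter.Tendsto (fun n => eLpNorm (L ∘ X n - L ∘ X') p P) l (𝓝 0) := by
  have h2 : Filter.Tendsto (fun n => (‖L‖₊ : ℝ≥0∞) * eLpNorm (X n - X') p P) l (𝓝 0) := by
    simpa using ENNReal.Tendsto.const_mul h (Or.inr (ENNReal.coe_ne_top (r := ‖L‖₊)))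
  refine tendsto_of_tendsto_of_tendsto_of_le_of_le tendsto_const_nhds h2 (fun _ => zero_le)
    fun n => ?_
  refine eLpNorm_le_nnreal_smul_eLpNorm_of_ae_le_mul (ae_of_all _ fun ω => ?_) p
  simp only [Pi.sub_apply, Function.comp_apply, ← map_sub]
  exact L.le_opNorm _

theorem memLp_inner_const {E : Type*} [NormedAddCommGroup E] [InnerProductSpace ℝ E]
    {Y : Ω → E} (hY : MemLp Y 2 P) (x : E) :
    MemLp (fun ω => ⟪x, Y ω⟫) 2 P :=
  (innerSL ℝ x).comp_memLp' hY

end L2Limits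

/-! ### Gaussianity of `L²` limits. -/

section GaussianLimits

variable {Ω E T : Type*} {mΩ : MeasurableSpace Ω} {P : Measure Ω} [IsProbabilityMeasure P]
  [NormedAddCommGroup E] [MeasurableSpace E] [BorelSpace E]

/-- `L²` convergence implies convergence in law, hence of characteristic functions; those of the `Y
n` depend only on mean and variance, which converge. The argument `1` suffices, since the lemma is
applied to every continuous functional of a random vector. -/
theorem charFun_map_one_of_tendsto_eLpNorm {Y : ℕ → Ω → ℝ} {Y' : Ω → ℝ}
    (hY : ∀ n, HasGaussianLaw (Y n) P) (hY' : MemLp Y' 2 P)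
    (h : Filter.Tendsto (fun n => eLpNorm (Y n - Y') 2 P) Filter.atTop (𝓝 0)) :
    charFun (P.map Y') 1 = Complex.exp ((∫ ω, Y' ω ∂P : ℝ) * Complex.I - Var[Y'; P] / 2) := by
  have hd := (tendstoInMeasure_of_tendsto_eLpNorm two_ne_zero
    (fun n => (hY n).memLp_two.aestronglyMeasurable) hY'.aestronglyMeasurable
    h).tendstoInDistribution fun n => (hY n).aemeasurable
  have h1 := ProbabilityMeasure.tendsto_iff_tendsto_charFun.1 hd.tendsto 1
  refine tendsto_nhds_unique h1 ?_
  have h2 := tendsto_integral_of_tendsto_eLpNorm_two (fun n => (hY n).memLp_two) hY' h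
  have h3 := tendsto_covariance_of_tendsto_eLpNorm (fun n => (hY n).memLp_two)
    (fun n => (hY n).memLp_two) hY' hY' h h
  rw [covariance_self hY'.aestronglyMeasurable.aemeasurable] at h3
  have h4 : ∀ n, charFun (P.map (Y n)) 1 =
      Complex.exp ((∫ ω, Y n ω ∂P : ℝ) * Complex.I - (cov[Y n, Y n; P] : ℝ) / 2) := fun n => by
    rw [covariance_self (hY n).aemeasurable, (hY n).charFun_map_eq]
    simp
  simp only [ProbabilityMeasure.coe_mk, h4]
  refine (Complex.continuous_exp.tendsto _).comp (Filter.Tendsto.sub ?_ ?_)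
  · exact ((Complex.continuous_ofReal.tendsto _).comp h2).mul_const _
  · exact ((Complex.continuous_ofReal.tendsto _).comp h3).div_const _

/-- An `L²`-limit of Gaussian processes is a Gaussian process. -/
theorem isGaussianProcess_of_tendsto_eLpNorm [NormedSpace ℝ E] [SecondCountableTopology E]
    {X : ℕ → T → Ω → E} {W : T → Ω → E}
    (hX : ∀ n, IsGaussianProcess (X n) P) (hXL : ∀ n t, MemLp (X n t) 2 P)
    (hW : ∀ t, MemLp (W t) 2 P)
    (h : ∀ t, Filter.Tendsto (fun n => eLpNorm (X n t - W t) 2 P) Filter.atTop (𝓝 0)) :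
    IsGaussianProcess W P where
  hasGaussianLaw I := by
    classical
    have hWm : AEMeasurable (fun ω => I.restrict (W · ω)) P :=
      aemeasurable_pi_lambda _ fun t => (hW t).aestronglyMeasurable.aemeasurable
    refine (hasGaussianLaw_iff_charFunDual_map_eq hWm).2 fun L => ?_
    -- A functional on a finite product is a sum of functionals of the coordinates, so convergence
    -- at each time is enough.
    have hL : ∀ Z : T → Ω → E, L ∘ (fun ω => I.restrict (Z · ω)) =
        ∑ k : I, (L ∘L .single ℝ _ k) ∘ Z k := by
      intro Z
      ext
      simp [-ContinuousLinearMap.comp_apply, ← L.sum_comp_single]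
    have hLW : MemLp (L ∘ fun ω => I.restrict (W · ω)) 2 P := by
      rw [hL]
      exact memLp_finsetSum' _ fun k _ => ContinuousLinearMap.comp_memLp' _ (hW k)
    have hlim : Filter.Tendsto (fun n => eLpNorm ((L ∘ fun ω => I.restrict (X n · ω)) -
        L ∘ fun ω => I.restrict (W · ω)) 2 P) Filter.atTop (𝓝 0) := by
      have h1 : Filter.Tendsto (fun n => ∑ k : I, eLpNorm ((L ∘L .single ℝ _ k) ∘ X n k -
          (L ∘L .single ℝ _ k) ∘ W k) 2 P) Filter.atTop (𝓝 0) := by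
        simpa using tendsto_finsetSum (Finset.univ : Finset I) fun k _ =>
          tendsto_eLpNorm_clm_comp (L ∘L .single ℝ (fun _ : I => E) k) (h k)
      refine tendsto_of_tendsto_of_tendsto_of_le_of_le tendsto_const_nhds h1 (fun _ => zero_le)
        fun n => ?_
      dsimp only
      rw [hL, hL, ← Finset.sum_sub_distrib]
      refine eLpNorm_sum_le (fun k _ => ?_) one_le_two
      exact ((ContinuousLinearMap.comp_memLp' _ (hXL n k)).sub
        (ContinuousLinearMap.comp_memLp' _ (hW k))).aestronglyMeasurable
    rw [← charFun_map_one_of_tendsto_eLpNorm (fun n => ((hX n).hasGaussianLaw I).map L) hLW hlim,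
      charFunDual_eq_charFun_map_one, AEMeasurable.map_map_of_aemeasurable (by fun_prop) hWm]

end GaussianLimits

/-! ### Independent increments from the covariance. -/

section IndependentIncrements

variable {Ω E : Type*} {mΩ : MeasurableSpace Ω} {P : Measure Ω} [IsProbabilityMeasure P]
  [NormedAddCommGroup E] [InnerProductSpace ℝ E]
  {X : ℝ≥0 → Ω → E} {B : E → E → ℝ}

/-- Bilinearity. For `s ≤ t` and `s' ≤ t'` the bracket is the length of the overlap of `[s, t]` and
`[s', t']`. -/
theorem covariance_inner_sub_sub (hX : ∀ t, MemLp (X t) 2 P)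
    (hcov : ∀ s t x y, cov[fun ω => ⟪x, X s ω⟫, fun ω => ⟪y, X t ω⟫; P] =
      (min s t : ℝ≥0) * B x y) (s t s' t' : ℝ≥0) (x y : E) :
    cov[fun ω => ⟪x, X t ω - X s ω⟫, fun ω => ⟪y, X t' ω - X s' ω⟫; P] =
      ((min t t' : ℝ≥0) - (min t s' : ℝ≥0) - ((min s t' : ℝ≥0) - (min s s' : ℝ≥0)) : ℝ)
        * B x y := by
  have hm := fun t x => memLp_inner_const (hX t) x
  simp_rw [inner_sub_right]
  rw [covariance_fun_sub_fun_sub (hm _ _) (hm _ _) (hm _ _) (hm _ _)]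
  simp_rw [hcov]
  ring

variable [CompleteSpace E] [SecondCountableTopology E] [MeasurableSpace E] [BorelSpace E]

theorem ProbabilityTheory.IsGaussianProcess.hasIndepIncrements_of_covariance
    (hX : IsGaussianProcess X P)
    (hcov : ∀ s t x y, cov[fun ω => ⟪x, X s ω⟫, fun ω => ⟪y, X t ω⟫; P] =
      (min s t : ℝ≥0) * B x y) : HasIndepIncrements X P := by
  intro n t ht
  refine hX.hasGaussianLaw_increments.iIndepFun_of_covariance_inner fun i j hij x y => ?_
  rw [covariance_inner_sub_sub (fun t => (hX.hasGaussianLaw_eval t).memLp_two) hcov]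
  -- One interval lies before the other, so each minimum is an endpoint of the earlier one and the
  -- four terms cancel.
  rcases hij.lt_or_gt with h | h
  · have h0 : i.succ ≤ j.castSucc := h
    rw [min_eq_left (ht (h0.trans j.castSucc_le_succ)), min_eq_left (ht h0),
      min_eq_left (ht (i.castSucc_le_succ.trans (h0.trans j.castSucc_le_succ))),
      min_eq_left (ht (i.castSucc_le_succ.trans h0))]
    simp
  · have h0 : j.succ ≤ i.castSucc := h
    rw [min_eq_right (ht (h0.trans i.castSucc_le_succ)), min_eq_right (ht h0),
      min_eq_right (ht (j.castSucc_le_succ.trans (h0.trans i.castSucc_le_succ))),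
      min_eq_right (ht (j.castSucc_le_succ.trans h0))]
    simp

end IndependentIncrements

/-! ### Finite sums `∑ j ∈ F, β j t • a j`. -/

section PartialSums

variable {ι Ω : Type*} {mΩ : MeasurableSpace Ω} {P : Measure Ω} {β : ι → ℝ≥0 → Ω → ℝ}

theorem isGaussianProcess_of_iIndepFun {T : Type*} {β : ι → T → Ω → ℝ}
    (hβ : ∀ j, IsGaussianProcess (β j) P) (hindep : iIndepFun (fun j ω t => β j t ω) P) :
    IsGaussianProcess (fun (p : ι × T) ω => β p.1 p.2 ω) P where
  hasGaussianLaw I := by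
    classical
    -- The finite set `I` is enclosed in the rectangle `J × K`: the vectors `(β j t)` with `t ∈ K`
    -- are independent and Gaussian, hence jointly Gaussian, and restriction to `I` is linear.
    let J := I.image Prod.fst
    let K := I.image Prod.snd
    have h1 : iIndepFun (fun (j : J) ω => K.restrict (β j · ω)) P :=
      (hindep.comp (fun _ (f : T → ℝ) => K.restrict f) (fun _ => K.measurable_restrict)).precomp
        (g := fun j : J => (j : ι)) Subtype.val_injective
    have h2 := iIndepFun.hasGaussianLaw (ι := J) (E := fun _ => K → ℝ)
      (X := fun j ω => K.restrict (β j · ω)) (fun j => (hβ j).hasGaussianLaw K) h1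
    let L : (J → K → ℝ) →L[ℝ] (I → ℝ) :=
      { toFun := fun x p => x ⟨p.1.1, Finset.mem_image_of_mem _ p.2⟩
          ⟨p.1.2, Finset.mem_image_of_mem _ p.2⟩
        map_add' := fun _ _ => rfl
        map_smul' := fun _ _ => rfl }
    exact h2.map L

theorem memLp_brownian {B : ℝ≥0 → Ω → ℝ} (hB : IsPreBrownianReal B P) (t : ℝ≥0) :
    MemLp (B t) 2 P :=
  (hB.hasLaw_eval t).hasGaussianLaw.memLp_two

theorem covariance_of_iIndepFun [IsProbabilityMeasure P] [DecidableEq ι]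
    (hβ : ∀ j, IsPreBrownianReal (β j) P)
    (hindep : iIndepFun (fun j ω t => β j t ω) P) (j k : ι) (s t : ℝ≥0) :
    cov[fun ω => β j s ω, fun ω => β k t ω; P] = if j = k then ((min s t : ℝ≥0) : ℝ) else 0 := by
  split_ifs with h
  · rw [h, (hβ k).covariance_fun_eval]
  · have h1 : IndepFun (β j s) (β k t) P :=
      (hindep.indepFun h).comp (measurable_pi_apply s) (measurable_pi_apply t)
    exact h1.covariance_eq_zero (memLp_brownian (hβ j) s)
      (memLp_brownian (hβ k) t)

variable {E : Type*} [NormedAddCommGroup E] [InnerProductSpace ℝ E]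

/-- The partial sums `∑ j ∈ F, β j t • a j` of a series with random coefficients. -/
def partialSum (a : ι → E) (β : ι → ℝ≥0 → Ω → ℝ) (F : Finset ι) (t : ℝ≥0) (ω : Ω) : E :=
  ∑ j ∈ F, β j t ω • a j

theorem memLp_smul_brownian (hβ : ∀ j, IsPreBrownianReal (β j) P) (a : ι → E) (j : ι) (t : ℝ≥0) :
    MemLp (fun ω => β j t ω • a j) 2 P :=
  ((ContinuousLinearMap.id ℝ ℝ).smulRight (a j)).comp_memLp'
    (memLp_brownian (hβ j) t)

theorem memLp_partialSum (hβ : ∀ j, IsPreBrownianReal (β j) P) (a : ι → E) (F : Finset ι)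
    (t : ℝ≥0) : MemLp (partialSum a β F t) 2 P :=
  memLp_finsetSum _ fun j _ => memLp_smul_brownian hβ a j t

theorem stronglyMeasurable_partialSum {m : MeasurableSpace Ω} {t : ℝ≥0}
    (hβ : ∀ j, StronglyMeasurable[m] (β j t)) (a : ι → E) (F : Finset ι) :
    StronglyMeasurable[m] (partialSum a β F t) :=
  Finset.stronglyMeasurable_fun_sum _ fun j _ => (hβ j).smul_const (a j)

theorem isGaussianProcess_partialSum [MeasurableSpace E] [BorelSpace E] [SecondCountableTopology E]
    (hβ : ∀ j, IsPreBrownianReal (β j) P) (hindep : iIndepFun (fun j ω t => β j t ω) P)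
    (a : ι → E) (F : Finset ι) : IsGaussianProcess (partialSum a β F) P := by
  classical
  have hG := isGaussianProcess_of_iIndepFun
    (fun j => IsPreBrownianReal.isGaussianProcess (hβ j)) hindep
  refine IsGaussianProcess.of_isGaussianProcess hG fun t => ⟨F.image fun j => (j, t), ?_⟩
  refine ⟨∑ j ∈ F.attach, (ContinuousLinearMap.proj (R := ℝ)
    (φ := fun _ : F.image fun j => (j, t) => ℝ)
    ⟨(j.1, t), Finset.mem_image_of_mem _ j.2⟩).smulRight (a j.1), fun ω => ?_⟩
  rw [partialSum, ← Finset.sum_attach]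
  simp

theorem integral_partialSum [CompleteSpace E] (hβ : ∀ j, IsPreBrownianReal (β j) P) (a : ι → E)
    (F : Finset ι) (t : ℝ≥0) : ∫ ω, partialSum a β F t ω ∂P = 0 := by
  unfold partialSum
  rw [integral_finsetSum _ fun j _ => ((hβ j).integrable_eval t).smul_const (a j)]
  refine Finset.sum_eq_zero fun j _ => ?_
  rw [integral_smul_const]
  have h := (hβ j).integral_eval t
  rw [h, zero_smul]

theorem covariance_partialSum [IsProbabilityMeasure P] (hβ : ∀ j, IsPreBrownianReal (β j) P)
    (hindep : iIndepFun (fun j ω t => β j t ω) P) (a : ι → E) (F : Finset ι) (s t : ℝ≥0)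
    (x y : E) :
    cov[fun ω => ⟪x, partialSum a β F s ω⟫, fun ω => ⟪y, partialSum a β F t ω⟫; P] =
      (min s t : ℝ≥0) * ∑ j ∈ F, ⟪a j, x⟫ * ⟪a j, y⟫ := by
  classical
  have hm : ∀ j t x, MemLp (fun ω => β j t ω * ⟪a j, x⟫) 2 P := fun j t x =>
    (memLp_brownian (hβ j) t).mul_const _
  have h1 : ∀ t x, (fun ω => ⟪x, partialSum a β F t ω⟫) =
      fun ω => ∑ j ∈ F, β j t ω * ⟪a j, x⟫ := fun t x => by
    ext ω
    simp [partialSum, inner_sum, inner_smul_right, real_inner_comm x]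
  rw [h1, h1, covariance_fun_sum_fun_sum' (fun j _ => hm j s x) (fun j _ => hm j t y),
    Finset.mul_sum]
  refine Finset.sum_congr rfl fun j hj => ?_
  simp_rw [covariance_mul_const_left, covariance_mul_const_right,
    covariance_of_iIndepFun hβ hindep]
  rw [Finset.sum_eq_single_of_mem j hj fun k _ hk => by simp [hk.symm]]
  simp only [if_true]
  ring

theorem integral_norm_sq_partialSum [IsProbabilityMeasure P]
    (hβ : ∀ j, IsPreBrownianReal (β j) P)
    (hindep : iIndepFun (fun j ω t => β j t ω) P) (a : ι → E) (F : Finset ι) (t : ℝ≥0) :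
    ∫ ω, ‖partialSum a β F t ω‖ ^ 2 ∂P = t * ∑ j ∈ F, ‖a j‖ ^ 2 := by
  classical
  have hm := fun j => memLp_brownian (hβ j) t
  have hint : ∀ j k, Integrable (fun ω => β j t ω * β k t ω * ⟪a j, a k⟫) P := fun j k =>
    ((hm j).integrable_mul (hm k)).mul_const _
  have h1 : ∀ ω, ‖partialSum a β F t ω‖ ^ 2 =
      ∑ j ∈ F, ∑ k ∈ F, β j t ω * β k t ω * ⟪a j, a k⟫ := fun ω => by
    rw [← real_inner_self_eq_norm_sq, partialSum, sum_inner]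
    refine Finset.sum_congr rfl fun j _ => ?_
    rw [inner_sum]
    refine Finset.sum_congr rfl fun k _ => ?_
    rw [real_inner_smul_left, real_inner_smul_right, mul_assoc]
  have h2 : ∀ j k, ∫ ω, β j t ω * β k t ω ∂P = if j = k then (t : ℝ) else 0 := fun j k => by
    have h3 := covariance_of_iIndepFun hβ hindep j k t t
    rw [min_self] at h3
    rw [← h3]
    have h4 := covariance_eq_sub (hm j) (hm k)
    rw [(hβ j).integral_eval, zero_mul, sub_zero] at h4
    exact h4.symm
  simp_rw [h1]
  rw [integral_finsetSum _ fun j _ => integrable_finsetSum _ fun k _ => hint j k, Finset.mul_sum]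
  refine Finset.sum_congr rfl fun j hj => ?_
  rw [integral_finsetSum _ fun k _ => hint j k]
  simp_rw [integral_mul_const, h2]
  rw [Finset.sum_eq_single_of_mem j hj fun k _ hk => by simp [hk.symm]]
  simp

theorem eLpNorm_partialSum [IsProbabilityMeasure P]
    (hβ : ∀ j, IsPreBrownianReal (β j) P)
    (hindep : iIndepFun (fun j ω t => β j t ω) P) (a : ι → E) (F : Finset ι) (t : ℝ≥0) :
    eLpNorm (partialSum a β F t) 2 P = ENNReal.ofReal √(t * ∑ j ∈ F, ‖a j‖ ^ 2) := by
  rw [(memLp_partialSum hβ a F t).eLpNorm_eq_integral_rpow_norm two_ne_zero ENNReal.ofNat_ne_top,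
    Real.sqrt_eq_rpow, ← integral_norm_sq_partialSum hβ hindep]
  simp

theorem integral_norm_partialSum_le [IsProbabilityMeasure P]
    (hβ : ∀ j, IsPreBrownianReal (β j) P)
    (hindep : iIndepFun (fun j ω t => β j t ω) P) (a : ι → E) (F : Finset ι) (t : ℝ≥0) :
    ENNReal.ofReal (∫ ω, ‖partialSum a β F t ω‖ ∂P) ≤
      ENNReal.ofReal √(t * ∑ j ∈ F, ‖a j‖ ^ 2) := by
  have hm := memLp_partialSum hβ a F t
  rw [ofReal_integral_norm_eq_lintegral_enorm (hm.integrable one_le_two),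
    ← eLpNorm_one_eq_lintegral_enorm, ← eLpNorm_partialSum hβ hindep]
  exact eLpNorm_le_eLpNorm_of_exponent_le one_le_two hm.aestronglyMeasurable

/-- Maximal inequality for the partial sums of the series. -/
theorem measure_exists_lt_norm_partialSum [IsProbabilityMeasure P] [CompleteSpace E]
    [MeasurableSpace E] [BorelSpace E] [SecondCountableTopology E]
    (hβ : ∀ j, IsBrownianReal (β j) P) (hmeas : ∀ j t, StronglyMeasurable (β j t))
    (hindep : iIndepFun (fun j ω t => β j t ω) P) (a : ι → E) (F : Finset ι) (ε : ℝ≥0) (T : ℕ) :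
    ε * P {ω | ∃ t : ℝ≥0, t ≤ T ∧ (ε : ℝ) < ‖partialSum a β F t ω‖} ≤
      ENNReal.ofReal √(T * ∑ j ∈ F, ‖a j‖ ^ 2) := by
  have hβ' := fun j => (hβ j).toIsPreBrownianReal
  have hG := isGaussianProcess_partialSum hβ' hindep a F
  have h := measure_exists_lt_norm_of_hasIndepIncrements
    (fun t => stronglyMeasurable_partialSum (fun j => hmeas j t) a F)
    (fun t => (memLp_partialSum hβ' a F t).integrable one_le_two)
    (integral_partialSum hβ' a F)
    (hG.hasIndepIncrements_of_covariance (covariance_partialSum hβ' hindep a F)) ?_ ?_ ε T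
  · simpa using h.trans (integral_norm_partialSum_le hβ' hindep a F T)
  · have h0 : ∀ᵐ ω ∂P, ∀ j : F, β j 0 ω = 0 :=
      ae_all_iff.2 fun j => (hβ' j).eval_zero_ae_eq_zero
    filter_upwards [h0] with ω hω
    exact Finset.sum_eq_zero fun j hj => by rw [hω ⟨j, hj⟩, zero_smul]
  · have h0 : ∀ᵐ ω ∂P, ∀ j : F, Continuous (β j · ω) := ae_all_iff.2 fun j => (hβ j).cont
    filter_upwards [h0] with ω hω
    exact continuous_finsetSum _ fun j hj => (hω ⟨j, hj⟩).smul continuous_const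

end PartialSums

/-! ### Deterministic lemmas on geometric convergence and summable tails. -/

section LocallyUniformLimits

theorem tendsto_limUnder_and_continuous_of_dist_le_geometric {E : Type*} [NormedAddCommGroup E]
    [CompleteSpace E] {f : ℕ → ℝ≥0 → E} (hf : ∀ n, Continuous (f n))
    (h : ∀ T : ℕ, ∀ᶠ k in Filter.atTop, ∀ t : ℝ≥0, t ≤ T →
      ‖f (k + 1) t - f k t‖ ≤ (1 / 2 : ℝ) ^ k) :
    (∀ t, Filter.Tendsto (fun k => f k t) Filter.atTop
      (𝓝 (Filter.atTop.limUnder fun k => f k t))) ∧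
    Continuous fun t => Filter.atTop.limUnder fun k => f k t := by
  have hbd : ∀ T : ℕ, ∃ N, ∀ t : ℝ≥0, t ≤ T → ∀ k,
      dist (f (k + N) t) (f (k + 1 + N) t) ≤ (1 / 2 : ℝ) ^ N * (1 / 2 : ℝ) ^ k := by
    intro T
    obtain ⟨N, hN⟩ := Filter.eventually_atTop.1 (h T)
    refine ⟨N, fun t ht k => ?_⟩
    rw [dist_comm, dist_eq_norm, ← pow_add, add_comm N, add_right_comm]
    exact hN (k + N) (Nat.le_add_left _ _) t ht
  have hlim : ∀ t, Filter.Tendsto (fun k => f k t) Filter.atTop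
      (𝓝 (Filter.atTop.limUnder fun k => f k t)) := by
    intro t
    obtain ⟨T, hT⟩ := exists_nat_ge t
    obtain ⟨N, hN⟩ := hbd T
    obtain ⟨y, hy⟩ := cauchySeq_tendsto_of_complete
      (cauchySeq_of_le_geometric (1 / 2) _ one_half_lt_one (hN t hT))
    exact tendsto_nhds_limUnder ⟨y, (Filter.tendsto_add_atTop_iff_nat N).1 hy⟩
  refine ⟨hlim, ?_⟩
  have huni : TendstoLocallyUniformly f (fun t => Filter.atTop.limUnder fun k => f k t)
      Filter.atTop := by
    refine tendstoLocallyUniformly_of_forall_exists_nhds fun t => ?_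
    obtain ⟨T, hT⟩ := exists_nat_gt t
    refine ⟨Set.Iic (T : ℝ≥0), Iic_mem_nhds hT, ?_⟩
    obtain ⟨N, hN⟩ := hbd T
    have h0 : Filter.Tendsto (fun k : ℕ => (1 / 2 : ℝ) ^ N * (1 / 2 : ℝ) ^ (k - N) / (1 - 1 / 2))
        Filter.atTop (𝓝 0) := by
      have h1 := (tendsto_pow_atTop_nhds_zero_of_lt_one (r := (1 / 2 : ℝ)) (by norm_num)
        one_half_lt_one).comp (Filter.tendsto_sub_atTop_nat N)
      simpa using (h1.const_mul ((1 / 2 : ℝ) ^ N)).div_const (1 - 1 / 2)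
    rw [Metric.tendstoUniformlyOn_iff]
    intro ε hε
    filter_upwards [h0.eventually_lt_const hε, Filter.eventually_ge_atTop N] with k hk hkN s hs
    refine lt_of_le_of_lt ?_ hk
    have h2 := dist_le_of_le_geometric_of_tendsto (1 / 2) _ one_half_lt_one (hN s hs)
      ((Filter.tendsto_add_atTop_iff_nat N).2 (hlim s)) (k - N)
    rwa [Nat.sub_add_cancel hkN, dist_comm] at h2
  exact huni.continuous (Filter.Frequently.of_forall hf)

theorem exists_monotone_finset_sum_le {ι : Type*} {f : ι → ℝ} (hf : Summable f) {δ : ℕ → ℝ}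
    (hδ : ∀ k, 0 < δ k) : ∃ F : ℕ → Finset ι, Monotone F ∧
      ∀ k (G : Finset ι), Disjoint G (F k) → ∑ j ∈ G, f j ≤ δ k := by
  classical
  choose s hs using fun k => summable_iff_vanishing_norm.1 hf (δ k) (hδ k)
  -- Unions of the Cauchy sets make the sequence monotone and only shrink the complements.
  refine ⟨fun k => (Finset.range (k + 1)).biUnion s, fun k l hkl => ?_, fun k G hG => ?_⟩
  · exact Finset.biUnion_subset_biUnion_of_subset_left _ (Finset.range_mono (by lia))
  · refine (le_abs_self _).trans (hs k G (hG.mono_right ?_)).le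
    exact Finset.subset_biUnion_of_mem s (Finset.self_mem_range_succ k)

end LocallyUniformLimits

/-! ### Almost sure and `L²` convergence of the series. -/

section Series

variable {ι Ω E : Type*} {mΩ : MeasurableSpace Ω} {P : Measure Ω}
  {β : ι → ℝ≥0 → Ω → ℝ} [NormedAddCommGroup E] [InnerProductSpace ℝ E]
  {a : ι → E} {F : ℕ → Finset ι}

theorem partialSum_sub_of_subset [DecidableEq ι] {G H : Finset ι} (h : G ⊆ H) (t : ℝ≥0) (ω : Ω) :
    partialSum a β H t ω - partialSum a β G t ω = partialSum a β (H \ G) t ω :=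
  sub_eq_of_eq_add (Finset.sum_sdiff h).symm

/-- The limit of the partial sums along the finite sets `F k`. -/
noncomputable def seriesLimit (a : ι → E) (β : ι → ℝ≥0 → Ω → ℝ) (F : ℕ → Finset ι) (t : ℝ≥0)
    (ω : Ω) : E :=
  Filter.atTop.limUnder fun k => partialSum a β (F k) t ω

/-- `limUnder` of measurable functions is measurable even where the sequence diverges, so no
completion of the filtration is needed. -/
theorem stronglyAdapted_seriesLimit [CompleteSpace E] {ℱ : Filtration ℝ≥0 mΩ}
    (hβ : ∀ j, StronglyAdapted ℱ (β j)) :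
    StronglyAdapted ℱ (seriesLimit a β F) := fun t =>
  @StronglyMeasurable.limUnder _ _ _ (ℱ t) _ _ _ _ _ _ _
    fun k => stronglyMeasurable_partialSum (fun j => hβ j t) a (F k)

variable [IsProbabilityMeasure P]

theorem ae_tendsto_and_continuous_seriesLimit [CompleteSpace E] [MeasurableSpace E] [BorelSpace E]
    [SecondCountableTopology E]
    (hβ : ∀ j, IsBrownianReal (β j) P) (hmeas : ∀ j t, StronglyMeasurable (β j t))
    (hindep : iIndepFun (fun j ω t => β j t ω) P) (hF : Monotone F)
    (htail : ∀ k (G : Finset ι), Disjoint G (F k) → ∑ j ∈ G, ‖a j‖ ^ 2 ≤ (1 / 16 : ℝ) ^ k) :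
    ∀ᵐ ω ∂P, (∀ t, Filter.Tendsto (fun k => partialSum a β (F k) t ω) Filter.atTop
      (𝓝 (seriesLimit a β F t ω))) ∧ Continuous fun t => seriesLimit a β F t ω := by
  classical
  have hBC : ∀ T : ℕ, ∀ᵐ ω ∂P, ∀ᶠ k in Filter.atTop, ∀ t : ℝ≥0, t ≤ T →
      ‖partialSum a β (F (k + 1)) t ω - partialSum a β (F k) t ω‖ ≤ (1 / 2 : ℝ) ^ k := by
    intro T
    let A : ℕ → Set Ω := fun k => {ω | ∃ t : ℝ≥0, t ≤ T ∧
      (((1 / 2 : ℝ≥0) ^ k : ℝ≥0) : ℝ) < ‖partialSum a β (F (k + 1) \ F k) t ω‖}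
    -- A tail of `16⁻ᵏ` gives an `L¹` bound `√T * 4⁻ᵏ`; dividing by the threshold `2⁻ᵏ` leaves a
    -- summable `√T * 2⁻ᵏ`.
    have hA : ∀ k, P (A k) ≤ ENNReal.ofReal (√T * (1 / 2 : ℝ) ^ k) := by
      intro k
      have h1 := measure_exists_lt_norm_partialSum hβ hmeas hindep a (F (k + 1) \ F k)
        ((1 / 2 : ℝ≥0) ^ k) T
      have h2 : √(T * ∑ j ∈ F (k + 1) \ F k, ‖a j‖ ^ 2) ≤ √T * (1 / 4 : ℝ) ^ k := by
        rw [Real.sqrt_mul (Nat.cast_nonneg T)]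
        refine mul_le_mul_of_nonneg_left ?_ (Real.sqrt_nonneg _)
        refine Real.sqrt_le_iff.2 ⟨by positivity, ?_⟩
        refine (htail k _ Finset.sdiff_disjoint).trans_eq ?_
        rw [← pow_mul, mul_comm, pow_mul]; norm_num
      have h3 : (((1 / 2 : ℝ≥0) ^ k : ℝ≥0) : ℝ≥0∞) = ENNReal.ofReal ((1 / 2 : ℝ) ^ k) := by
        rw [← ENNReal.ofReal_coe_nnreal]; simp
      have h4 : ENNReal.ofReal (√T * (1 / 4 : ℝ) ^ k) =
          ENNReal.ofReal ((1 / 2 : ℝ) ^ k) * ENNReal.ofReal (√T * (1 / 2 : ℝ) ^ k) := by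
        rw [← ENNReal.ofReal_mul (by positivity), mul_left_comm, ← mul_pow]; norm_num
      have h5 := h1.trans (ENNReal.ofReal_le_ofReal h2)
      rw [h3, h4] at h5
      exact (ENNReal.mul_le_mul_iff_right (by simp) ENNReal.ofReal_ne_top).1 h5
    have hsum : ∑' k, P (A k) ≠ ∞ := by
      refine ne_top_of_le_ne_top ?_ (ENNReal.tsum_le_tsum hA)
      exact (summable_geometric_two.mul_left _).tsum_ofReal_ne_top
    filter_upwards [ae_eventually_notMem hsum] with ω hω
    filter_upwards [hω] with k hk t ht
    rw [partialSum_sub_of_subset (hF k.le_succ)]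
    simpa [A] using not_lt.1 fun h => hk ⟨t, ht, h⟩
  have hc : ∀ᵐ ω ∂P, ∀ k, ∀ j : F k, Continuous (β j · ω) :=
    ae_all_iff.2 fun k => ae_all_iff.2 fun j => (hβ j).cont
  filter_upwards [ae_all_iff.2 hBC, hc] with ω h1 h2
  exact tendsto_limUnder_and_continuous_of_dist_le_geometric
    (fun k => continuous_finsetSum _ fun j hj => (h2 k ⟨j, hj⟩).smul continuous_const) h1

/-- Fatou along `F k`, after a triangle inequality through `F K`, whence the factor `2`. Uniformity
in `G ⊇ F K` is what yields unconditional convergence. -/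
theorem eLpNorm_partialSum_sub_seriesLimit_le (hβ : ∀ j, IsPreBrownianReal (β j) P)
    (hindep : iIndepFun (fun j ω t => β j t ω) P) (hF : Monotone F)
    (htail : ∀ k (G : Finset ι), Disjoint G (F k) → ∑ j ∈ G, ‖a j‖ ^ 2 ≤ (1 / 16 : ℝ) ^ k)
    {t : ℝ≥0} (hlim : ∀ᵐ ω ∂P, Filter.Tendsto (fun k => partialSum a β (F k) t ω) Filter.atTop
      (𝓝 (seriesLimit a β F t ω))) {K : ℕ} {G : Finset ι} (hG : F K ⊆ G) :
    eLpNorm (partialSum a β G t - seriesLimit a β F t) 2 P ≤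
      ENNReal.ofReal (2 * √t * (1 / 4 : ℝ) ^ K) := by
  classical
  have hm := fun G => (memLp_partialSum hβ a G t).aestronglyMeasurable
  have hsmall : ∀ H : Finset ι, F K ⊆ H →
      eLpNorm (partialSum a β H t - partialSum a β (F K) t) 2 P ≤
        ENNReal.ofReal (√t * (1 / 4 : ℝ) ^ K) := by
    intro H hH
    have h1 : partialSum a β H t - partialSum a β (F K) t = partialSum a β (H \ F K) t := by
      ext ω; exact partialSum_sub_of_subset hH t ω
    rw [h1, eLpNorm_partialSum hβ hindep, Real.sqrt_mul t.coe_nonneg]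
    refine ENNReal.ofReal_le_ofReal (mul_le_mul_of_nonneg_left ?_ (Real.sqrt_nonneg _))
    refine Real.sqrt_le_iff.2 ⟨by positivity, ?_⟩
    refine (htail K _ Finset.sdiff_disjoint).trans_eq ?_
    rw [← pow_mul, mul_comm, pow_mul]; norm_num
  refine (Lp.eLpNorm_lim_le_liminf_eLpNorm
    (f := fun k => partialSum a β G t - partialSum a β (F k) t)
    (fun k => (hm G).sub (hm _)) _ ?_).trans ?_
  · filter_upwards [hlim] with ω hω
    exact hω.const_sub _
  · refine Filter.liminf_le_of_frequently_le' (Filter.Eventually.frequently ?_)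
    filter_upwards [Filter.eventually_ge_atTop K] with k hk
    have h1 : partialSum a β G t - partialSum a β (F k) t =
        (partialSum a β G t - partialSum a β (F K) t) -
          (partialSum a β (F k) t - partialSum a β (F K) t) := by abel
    rw [h1, mul_assoc, two_mul, ENNReal.ofReal_add (by positivity) (by positivity)]
    refine (eLpNorm_sub_le ((hm _).sub (hm _)) ((hm _).sub (hm _)) one_le_two).trans ?_
    exact add_le_add (hsmall G hG) (hsmall (F k) (hF hk))

theorem tendsto_eLpNorm_partialSum_sub_seriesLimit (hβ : ∀ j, IsPreBrownianReal (β j) P)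
    (hindep : iIndepFun (fun j ω t => β j t ω) P) (hF : Monotone F)
    (htail : ∀ k (G : Finset ι), Disjoint G (F k) → ∑ j ∈ G, ‖a j‖ ^ 2 ≤ (1 / 16 : ℝ) ^ k)
    {t : ℝ≥0} (hlim : ∀ᵐ ω ∂P, Filter.Tendsto (fun k => partialSum a β (F k) t ω) Filter.atTop
      (𝓝 (seriesLimit a β F t ω))) {κ : Type*} {l : Filter κ} {G : κ → Finset ι}
    (hG : ∀ K, ∀ᶠ n in l, F K ⊆ G n) :
    Filter.Tendsto (fun n => eLpNorm (partialSum a β (G n) t - seriesLimit a β F t) 2 P)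
      l (𝓝 0) := by
  have h0 : Filter.Tendsto (fun K : ℕ => ENNReal.ofReal (2 * √t * (1 / 4 : ℝ) ^ K))
      Filter.atTop (𝓝 0) := by
    rw [← ENNReal.ofReal_zero]
    refine ENNReal.tendsto_ofReal ?_
    simpa using (tendsto_pow_atTop_nhds_zero_of_lt_one (r := (1 / 4 : ℝ)) (by norm_num)
      (by norm_num)).const_mul (2 * √t)
  refine ENNReal.tendsto_nhds_zero.2 fun ε hε => ?_
  obtain ⟨K, hK⟩ := (h0.eventually_le_const hε).exists
  filter_upwards [hG K] with n hn
  exact (eLpNorm_partialSum_sub_seriesLimit_le hβ hindep hF htail hlim hn).trans hK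

theorem memLp_seriesLimit (hβ : ∀ j, IsPreBrownianReal (β j) P)
    (hindep : iIndepFun (fun j ω t => β j t ω) P) (hF : Monotone F)
    (htail : ∀ k (G : Finset ι), Disjoint G (F k) → ∑ j ∈ G, ‖a j‖ ^ 2 ≤ (1 / 16 : ℝ) ^ k)
    {t : ℝ≥0} (hlim : ∀ᵐ ω ∂P, Filter.Tendsto (fun k => partialSum a β (F k) t ω) Filter.atTop
      (𝓝 (seriesLimit a β F t ω))) : MemLp (seriesLimit a β F t) 2 P := by
  have hm := fun G => memLp_partialSum hβ a G t
  have h1 : MemLp (partialSum a β (F 0) t - seriesLimit a β F t) 2 P :=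
    ⟨(hm _).aestronglyMeasurable.sub
      (aestronglyMeasurable_of_tendsto_ae _ (fun k => (hm (F k)).aestronglyMeasurable) hlim),
      (eLpNorm_partialSum_sub_seriesLimit_le hβ hindep hF htail hlim subset_rfl).trans_lt
        ENNReal.ofReal_lt_top⟩
  simpa using (hm (F 0)).sub h1

end Series

/-- A series `∑ j, β j t • a j` of independent Brownian motions with square summable coefficients
converges to a Wiener process. -/
theorem exists_isWienerProcess_of_summable
    {E : Type*} [NormedAddCommGroup E] [InnerProductSpace ℝ E] [CompleteSpace E]
    [SecondCountableTopology E] [MeasurableSpace E] [BorelSpace E]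
    {ι : Type*} [Countable ι] {a : ι → E} (ha : Summable fun j => ‖a j‖ ^ 2)
    {Ω : Type*} {mΩ : MeasurableSpace Ω} {P : Measure Ω} [IsProbabilityMeasure P]
    {ℱ : Filtration ℝ≥0 mΩ} {β : ι → ℝ≥0 → Ω → ℝ}
    (hβ : ∀ j, IsBrownianReal (β j) P) (hβ_adapted : ∀ j, StronglyAdapted ℱ (β j))
    (hβ_indep : iIndepFun (fun j ω t => β j t ω) P) :
    ∃ W : ℝ≥0 → Ω → E,
      (∀ t, Filter.Tendsto (fun s : Finset ι => eLpNorm (partialSum a β s t - W t) 2 P)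
        Filter.atTop (𝓝 0)) ∧
      IsWienerProcess W (covOp a) ℱ P ∧ IsGaussianProcess W P := by
  have hβ' := fun j => (hβ j).toIsPreBrownianReal
  obtain ⟨F, hF, htail⟩ := exists_monotone_finset_sum_le ha (δ := fun k => (1 / 16 : ℝ) ^ k)
    fun k => by positivity
  have hae := ae_tendsto_and_continuous_seriesLimit hβ
    (fun j t => (hβ_adapted j t).mono (ℱ.le t)) hβ_indep hF htail
  have hlim : ∀ t, ∀ᵐ ω ∂P, Filter.Tendsto (fun k => partialSum a β (F k) t ω) Filter.atTop
      (𝓝 (seriesLimit a β F t ω)) := fun t => hae.mono fun ω h => h.1 t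
  have hW := fun t => memLp_seriesLimit hβ' hβ_indep hF htail (hlim t)
  -- Convergence along `F k` serves the Gaussian limit lemma, which takes sequences; convergence
  -- over all finite sets is the unconditional statement.
  have hL2 : ∀ t, Filter.Tendsto
      (fun k => eLpNorm (partialSum a β (F k) t - seriesLimit a β F t) 2 P) Filter.atTop (𝓝 0) :=
    fun t => tendsto_eLpNorm_partialSum_sub_seriesLimit hβ' hβ_indep hF htail (hlim t)
      fun K => (Filter.eventually_ge_atTop K).mono fun k hk => hF hk
  have hL2' : ∀ t, Filter.Tendsto
      (fun s : Finset ι => eLpNorm (partialSum a β s t - seriesLimit a β F t) 2 P)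
      Filter.atTop (𝓝 0) := fun t =>
    tendsto_eLpNorm_partialSum_sub_seriesLimit hβ' hβ_indep hF htail (hlim t)
      fun K => Filter.eventually_ge_atTop (F K)
  have hinner : ∀ t x, Filter.Tendsto (fun s : Finset ι =>
      eLpNorm ((fun ω => ⟪x, partialSum a β s t ω⟫) - fun ω => ⟪x, seriesLimit a β F t ω⟫) 2 P)
      Filter.atTop (𝓝 0) := fun t x => tendsto_eLpNorm_clm_comp (innerSL ℝ x) (hL2' t)
  have hS := fun s t x => memLp_inner_const (memLp_partialSum hβ' a s t) x
  have hcov : ∀ s t x y, cov[fun ω => ⟪x, seriesLimit a β F s ω⟫,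
      fun ω => ⟪y, seriesLimit a β F t ω⟫; P] = (min s t : ℝ≥0) * ⟪covOp a x, y⟫ := by
    intro s t x y
    refine tendsto_nhds_unique (tendsto_covariance_of_tendsto_eLpNorm (fun G => hS G s x)
      (fun G => hS G t y) (memLp_inner_const (hW s) x) (memLp_inner_const (hW t) y)
      (hinner s x) (hinner t y)) ?_
    simp_rw [covariance_partialSum hβ' hβ_indep]
    exact Filter.Tendsto.const_mul _ (hasSum_inner_covOp ha x y)
  have hG : IsGaussianProcess (seriesLimit a β F) P :=
    isGaussianProcess_of_tendsto_eLpNorm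
      (fun k => isGaussianProcess_partialSum hβ' hβ_indep a (F k))
      (fun k t => memLp_partialSum hβ' a (F k) t) hW hL2
  exact ⟨seriesLimit a β F, hL2',
    { isPositive := covOp_isPositive ha
      isNuclear := covOp_isNuclear ha
      memLp := hW
      zero := by
        filter_upwards [hlim 0, ae_all_iff.2 fun j => (hβ' j).eval_zero_ae_eq_zero] with ω h1 h2
        refine tendsto_nhds_unique h1 ?_
        simp [partialSum, h2]
      mean := fun t => by
        refine ext_inner_left ℝ fun x => ?_
        rw [← integral_inner ((hW t).integrable one_le_two), inner_zero_right]
        refine tendsto_nhds_unique (tendsto_integral_of_tendsto_eLpNorm_two (fun G => hS G t x)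
          (memLp_inner_const (hW t) x) (hinner t x)) ?_
        have h0 : ∀ G, ∫ ω, ⟪x, partialSum a β G t ω⟫ ∂P = 0 := fun G => by
          rw [integral_inner ((memLp_partialSum hβ' a G t).integrable one_le_two),
            integral_partialSum hβ', inner_zero_right]
        simp [h0]
      cov := fun s t hst x y => by
        simp_rw [fun ω (x : E) => real_inner_comm x (seriesLimit a β F t ω - seriesLimit a β F s ω)]
        rw [covariance_inner_sub_sub hW hcov]
        simp [hst]
      indep := hG.hasIndepIncrements_of_covariance hcov
      continuous := hae.mono fun ω h => h.2
      adapted := stronglyAdapted_seriesLimit hβ_adapted }, hG⟩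

theorem proposition1
    {U : Type*} [NormedAddCommGroup U] [InnerProductSpace ℝ U] [CompleteSpace U]
    {U₁ : Type*} [NormedAddCommGroup U₁] [InnerProductSpace ℝ U₁] [CompleteSpace U₁]
    [TopologicalSpace.SeparableSpace U₁] [MeasurableSpace U₁] [BorelSpace U₁]
    (Q : U →L[ℝ] U) (hQ : Q.IsPositive)
    (i : U →L[ℝ] U₁) (hi : Function.Injective i)
    (hJ : IsHilbertSchmidt (i ∘L U0.incl Q))
    {ι : Type*} [Countable ι] (g : HilbertBasis ι ℝ (U0 Q))
    {Ω : Type*} {mΩ : MeasurableSpace Ω} (P : Measure Ω) [IsProbabilityMeasure P]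
    (ℱ : Filtration ℝ≥0 mΩ) (β : ι → ℝ≥0 → Ω → ℝ)
    (hβ : ∀ j, IsBrownianReal (β j) P)
    (hβ_adapted : ∀ j, StronglyAdapted ℱ (β j))
    (hβ_indep : iIndepFun (fun j ω t => β j t ω) P) :
    ∃ (Q₁ : U₁ →L[ℝ] U₁) (W : ℝ≥0 → Ω → U₁),
      (∀ t : ℝ≥0,
        (∀ j, MemLp (fun ω => β j t ω • i (U0.incl Q (g j))) 2 P) ∧
        MemLp (W t) 2 P ∧
        Filter.Tendsto
          (fun s : Finset ι =>
            eLpNorm (fun ω => (∑ j ∈ s, β j t ω • i (U0.incl Q (g j))) - W t ω) 2 P)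
          Filter.atTop (𝓝 0)) ∧
      IsWienerProcess W Q₁ ℱ P ∧
      IsGaussianProcess W P ∧
      HasFiniteTrace Q₁ := by
  -- The Hilbert-Schmidt hypothesis, moved to the basis `g`.
  have ha : Summable fun j => ‖i (U0.incl Q (g j))‖ ^ 2 := hJ.summable g
  obtain ⟨W, hW, hWiener, hGauss⟩ := exists_isWienerProcess_of_summable ha hβ hβ_adapted hβ_indep
  exact ⟨covOp fun j => i (U0.incl Q (g j)), W,
    fun t => ⟨fun j => memLp_smul_brownian (fun j => (hβ j).toIsPreBrownianReal)
      (fun j => i (U0.incl Q (g j))) j t,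
      hWiener.memLp t, hW t⟩, hWiener, hGauss, covOp_hasFiniteTrace ha⟩
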